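/- **Proposition 1.7.** Let $(r_n)_{n\ge 1}$ be the increasing enumeration of the set $\{3^n : n\ge 1\}\cup\{3^n+n : n\ge 1\}$. There exists a $1$-correlation $(a(n))_{n\in\mathbb N}$, that is, a sequence $a(n)=\int_X f(x)\,g(T^n x)\,d\mu(x)$ where $T$ is an invertible measure preserving transformation of a standard Borel probability space $(X,\mathcal B,\mu)$ and $f,g:X\to\mathbb C$ are bounded measurable functions, such that for every almost periodic sequence $(\psi(n))_{n\in\mathbb N}$, $$\liminf_{N\to\infty}\frac1N\sum_{n=1}^{N}\bigl|a(r_n)-\psi(r_n)\bigr|>0 .$$ Here a sequence is almost periodic if it is a uniform limit of $1$-step nilsequences, i.e. of sequences $\bigl(F(g^n\cdot x)\bigr)_{n\in\mathbb N}$ where $G$ is an abelian Lie group, $\Gamma$ a discrete cocompact subgroup, $g\in G$, $x\in G/\Gamma$, and $F:G/\Gamma\to\mathbb C$ is continuous. -/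

import Mathlib

open MeasureTheory Filter Topology
open scoped Manifold ContDiff

/-- `a` is a `k`-multiple correlation: there are a measure preserving system `(X, μ, T)`
(a standard Borel probability space with an invertible measure preserving transformation) and
bounded measurable functions `f 0, …, f k : X → ℂ` such that
`a n = ∫ f₀(x) f₁(Tⁿ x) ⋯ f_k(Tᵏⁿ x) dμ(x)` for all `n`. -/
def IsMultipleCorrelation (k : ℕ) (a : ℕ → ℂ) : Prop :=
  ∃ (X : Type) (_ : MeasurableSpace X) (_ : StandardBorelSpace X)
    (μ : Measure X) (_ : IsProbabilityMeasure μ) (T : X ≃ᵐ X) (f : Fin (k + 1) → X → ℂ),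
    MeasurePreserving T μ μ ∧
    (∀ j, Measurable (f j)) ∧
    (∀ j, ∃ C : ℝ, ∀ x, ‖f j x‖ ≤ C) ∧
    ∀ n : ℕ, a n = ∫ x, ∏ j : Fin (k + 1), f j (T^[(j : ℕ) * n] x) ∂μ

/-- `ψ` is a `k`-step nilsequence: `ψ n = F (gⁿ • x)` where `G` is a (Hausdorff, real, finite
dimensional) Lie group that is nilpotent of step at most `k`, `Γ` is a discrete cocompact subgroup
of `G`, `g ∈ G`, `x ∈ G ⧸ Γ`, and `F : G ⧸ Γ → ℂ` is continuous. The group `G` acts on `G ⧸ Γ` by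
left translation. -/
def IsNilsequence (k : ℕ) (ψ : ℕ → ℂ) : Prop :=
  ∃ (G : Type) (_ : Group G) (_ : TopologicalSpace G) (_ : T2Space G)
    (d : ℕ) (_ : ChartedSpace (EuclideanSpace ℝ (Fin d)) G) (_ : LieGroup (𝓡 d) ∞ G)
    (Γ : Subgroup G) (F : C(G ⧸ Γ, ℂ)) (g : G) (x : G ⧸ Γ),
    (⊤ : Subgroup G).lowerCentralSeries k = ⊥ ∧
    DiscreteTopology Γ ∧
    CompactSpace (G ⧸ Γ) ∧
    ∀ n : ℕ, ψ n = F (g ^ n • x)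

/-- `ψ` is a uniform limit of `k`-step nilsequences. -/
def IsUniformLimitOfNilsequences (k : ℕ) (ψ : ℕ → ℂ) : Prop :=
  ∀ ε : ℝ, 0 < ε → ∃ φ : ℕ → ℂ, IsNilsequence k φ ∧ ∀ n : ℕ, ‖ψ n - φ n‖ < ε

/-- (Bohr) almost periodic sequences: uniform limits of `1`-step nilsequences. -/
def IsAlmostPeriodic (ψ : ℕ → ℂ) : Prop :=
  IsUniformLimitOfNilsequences 1 ψ

/-! The sequence is the Fourier transform of the Cantor measure at the natural numbers.
Self-similarity peels off one factor per power of 3 (`cantorFourier_eq`). At `3 ^ n` all these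
factors are 1, so the value is a nonzero constant. At `3 ^ n + n` one factor has modulus 1/2, while
the remaining argument `1 + n / 3 ^ n` tends to 1. So the two values stay a fixed distance apart
(`eventually_cantorFourier_separated`).

An almost periodic `ψ` nearly agrees at `3 ^ s` and `3 ^ s + s` whenever `s` is an almost period,
and almost periods have bounded gaps. For each large such `s`, `ψ` must miss the correlation at one
of these two points. These misses recur within windows of bounded length in the enumeration, hence a
positive lower mean (`liminf_mean_pos`). -/

/-- The first binary digit of the fractional part of `x`. -/
noncomputable def binaryDigit (x : ℝ) : ℝ := if Int.fract x < 1 / 2 then 0 else 1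

/-- The map reading the binary digits of `x` as (half of the) ternary digits of a point of the
Cantor set; it pushes Lebesgue measure on `[0, 1]` to the Cantor measure. -/
noncomputable def cantorMap (x : ℝ) : ℝ := ∑' j : ℕ, 2 * binaryDigit (2 ^ j * x) / 3 ^ (j + 1)

/-- The exponential `t ↦ exp (2 π i t)`. -/
noncomputable def expTwoPi (t : ℝ) : ℂ := Complex.exp (2 * Real.pi * t * Complex.I)

/-- The Fourier transform of the Cantor measure. -/
noncomputable def cantorFourier (t : ℝ) : ℂ := ∫ x in (0 : ℝ)..1, expTwoPi (t * cantorMap x)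

/-- The factor in the infinite product formula for the Fourier transform of the Cantor measure. -/
noncomputable def cantorFactor (t : ℝ) : ℂ := (1 + expTwoPi (2 * t)) / 2

/-! ### Digits and the Cantor map -/

lemma binaryDigit_nonneg (x : ℝ) : 0 ≤ binaryDigit x := by
  unfold binaryDigit; split_ifs <;> norm_num

lemma binaryDigit_le_one (x : ℝ) : binaryDigit x ≤ 1 := by
  unfold binaryDigit; split_ifs <;> norm_num

lemma binaryDigit_add_nat (x : ℝ) (n : ℕ) : binaryDigit (x + n) = binaryDigit x := by
  simp [binaryDigit]

lemma measurable_binaryDigit : Measurable binaryDigit :=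
  Measurable.ite (measurableSet_lt measurable_fract measurable_const) measurable_const
    measurable_const

lemma summable_cantorMap (x : ℝ) :
    Summable fun j : ℕ => 2 * binaryDigit (2 ^ j * x) / 3 ^ (j + 1) := by
  refine Summable.of_nonneg_of_le (fun j => ?_) (fun j => ?_)
    (summable_geometric_of_lt_one (by norm_num : (0 : ℝ) ≤ 1 / 3) (by norm_num))
  · have := binaryDigit_nonneg (2 ^ j * x); positivity
  · have h1 := binaryDigit_le_one (2 ^ j * x)
    rw [one_div, inv_pow, ← one_div, div_le_div_iff₀ (by positivity) (by positivity), pow_succ]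
    have : (0 : ℝ) < 3 ^ j := by positivity
    nlinarith

lemma cantorMap_eq (x : ℝ) :
    cantorMap x = 2 * binaryDigit x / 3 + cantorMap (2 * x) / 3 := by
  rw [cantorMap, (summable_cantorMap x).tsum_eq_zero_add, cantorMap, ← tsum_div_const]
  congr 1
  · simp
  · refine tsum_congr fun j => ?_
    rw [pow_succ 2 j, mul_assoc, pow_succ 3 (j + 1), div_div]

lemma cantorMap_periodic : Function.Periodic cantorMap 1 := by
  intro x
  refine tsum_congr fun j => ?_
  have := binaryDigit_add_nat (2 ^ j * x) (2 ^ j)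
  push_cast at this
  rw [mul_add, mul_one, this]

lemma measurable_cantorMap : Measurable cantorMap :=
  Measurable.tsum fun _ => (((measurable_binaryDigit.comp
    (measurable_const.mul measurable_id)).const_mul 2).div_const _)

/-! ### Exponentials and the product factors -/

lemma expTwoPi_add (s t : ℝ) : expTwoPi (s + t) = expTwoPi s * expTwoPi t := by
  rw [expTwoPi, expTwoPi, expTwoPi, ← Complex.exp_add]; push_cast; ring_nf

lemma norm_expTwoPi (t : ℝ) : ‖expTwoPi t‖ = 1 := by
  rw [expTwoPi, ← Complex.norm_exp_ofReal_mul_I (2 * Real.pi * t)]; push_cast; rfl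

lemma continuous_expTwoPi : Continuous expTwoPi := by
  unfold expTwoPi; fun_prop

lemma expTwoPi_zero : expTwoPi 0 = 1 := by simp [expTwoPi]

lemma expTwoPi_eq_one_iff (t : ℝ) : expTwoPi t = 1 ↔ ∃ n : ℤ, t = n := by
  rw [expTwoPi, Complex.exp_eq_one_iff]
  refine exists_congr fun n => ?_
  have h : (2 * Real.pi * t * Complex.I : ℂ) = t * (2 * Real.pi * Complex.I) := by ring
  rw [h, mul_left_inj' Complex.two_pi_I_ne_zero]
  exact_mod_cast Iff.rfl

lemma expTwoPi_int (n : ℤ) : expTwoPi n = 1 := (expTwoPi_eq_one_iff _).2 ⟨n, rfl⟩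

lemma expTwoPi_nat (n : ℕ) : expTwoPi n = 1 := by exact_mod_cast expTwoPi_int n

lemma cantorFactor_nat (n : ℕ) : cantorFactor n = 1 := by
  have := expTwoPi_nat (2 * n)
  push_cast at this
  rw [cantorFactor, this]; norm_num

lemma cantorFactor_nat_add (n : ℕ) (t : ℝ) : cantorFactor (n + t) = cantorFactor t := by
  have := expTwoPi_nat (2 * n)
  push_cast at this
  rw [cantorFactor, mul_add, expTwoPi_add, this, one_mul, cantorFactor]

lemma norm_cantorFactor_le (t : ℝ) : ‖cantorFactor t‖ ≤ 1 := by
  rw [cantorFactor, norm_div]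
  have := norm_add_le 1 (expTwoPi (2 * t))
  rw [norm_expTwoPi, norm_one] at this
  norm_num
  linarith

/-- The exponential involved is a nontrivial cube root of unity `u`, and `1 + u = -u ^ 2`. -/
lemma norm_cantorFactor_div_three {m : ℕ} (hm : ¬ 3 ∣ m) :
    ‖cantorFactor ((m : ℝ) / 3)‖ = 1 / 2 := by
  set u := expTwoPi (2 * ((m : ℝ) / 3)) with hu
  have h3 : u ^ 3 = 1 := by
    have : u ^ 3 = expTwoPi ((2 * m : ℕ) : ℝ) := by
      rw [pow_succ, pow_two, hu, ← expTwoPi_add, ← expTwoPi_add]; congr 1; push_cast; ring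
    rw [this, expTwoPi_nat]
  have h1 : u ≠ 1 := by
    intro h
    obtain ⟨n, hn⟩ := (expTwoPi_eq_one_iff _).1 h
    have : (2 * m : ℤ) = 3 * n := by
      have : (2 * m : ℝ) = 3 * n := by linarith
      exact_mod_cast this
    omega
  have h2 : 1 + u = -u ^ 2 := by
    have : (u - 1) * (1 + u + u ^ 2) = 0 := by linear_combination h3
    have := (mul_eq_zero.1 this).resolve_left (sub_ne_zero.2 h1)
    linear_combination this
  rw [cantorFactor, ← hu, h2, norm_div, norm_neg, norm_pow, hu, norm_expTwoPi]
  norm_num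

/-- A zero would force `3 ^ (n + 1)` to divide 4. -/
lemma cantorFactor_inv_three_pow_ne_zero (n : ℕ) : cantorFactor (1 / 3 ^ (n + 1)) ≠ 0 := by
  intro h
  set u := expTwoPi (2 * (1 / 3 ^ (n + 1))) with hu
  have h1 : u = -1 := by
    have : (1 + u) / 2 = 0 := h
    linear_combination 2 * this
  have h2 : expTwoPi (2 * (1 / 3 ^ (n + 1)) + 2 * (1 / 3 ^ (n + 1))) = 1 := by
    rw [expTwoPi_add, ← hu, h1]; norm_num
  obtain ⟨k, hk⟩ := (expTwoPi_eq_one_iff _).1 h2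
  have h4 : (4 : ℤ) = k * 3 ^ (n + 1) := by
    have : (4 : ℝ) = k * 3 ^ (n + 1) := by rw [← hk]; field_simp; norm_num
    exact_mod_cast this
  rw [pow_succ, ← mul_assoc] at h4
  omega

/-! ### The Fourier transform of the Cantor measure -/

lemma measurable_expTwoPi_cantorMap (t : ℝ) : Measurable fun x => expTwoPi (t * cantorMap x) :=
  continuous_expTwoPi.measurable.comp (measurable_cantorMap.const_mul t)

lemma continuous_cantorFourier : Continuous cantorFourier := by
  refine intervalIntegral.continuous_of_dominated_interval (bound := fun _ => 1)
    (fun t => (measurable_expTwoPi_cantorMap t).aestronglyMeasurable)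
    (fun t => .of_forall fun x _ => (norm_expTwoPi _).le) (by simp) (.of_forall fun x _ => ?_)
  exact continuous_expTwoPi.comp (continuous_id.mul continuous_const)

lemma cantorFourier_zero : cantorFourier 0 = 1 := by
  simp [cantorFourier, expTwoPi_zero]

lemma norm_cantorFourier_le (t : ℝ) : ‖cantorFourier t‖ ≤ 1 := by
  have := intervalIntegral.norm_integral_le_of_norm_le_const (a := 0) (b := 1) (C := 1)
    (f := fun x => expTwoPi (t * cantorMap x)) (fun x _ => (norm_expTwoPi _).le)
  simpa [cantorFourier] using this

lemma intervalIntegrable_expTwoPi_cantorMap (t a b : ℝ) :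
    IntervalIntegrable (fun x => expTwoPi (t * cantorMap x)) volume a b := by
  refine (intervalIntegrable_const (c := (1 : ℝ))).mono_fun
    (measurable_expTwoPi_cantorMap t).aestronglyMeasurable (.of_forall fun x => ?_)
  simp [norm_expTwoPi]

/-- The self-similarity of the Cantor measure. -/
lemma cantorFourier_eq (t : ℝ) :
    cantorFourier t = cantorFactor (t / 3) * cantorFourier (t / 3) := by
  have hper : Function.Periodic (fun x => expTwoPi (t / 3 * cantorMap x)) 1 :=
    fun x => by simp only [cantorMap_periodic x]
  have hL : ∫ x in (0 : ℝ)..(1 / 2), expTwoPi (t * cantorMap x) = cantorFourier (t / 3) / 2 := by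
    have h := intervalIntegral.integral_comp_mul_left (a := 0) (b := 1 / 2)
      (fun x => expTwoPi (t / 3 * cantorMap x)) (two_ne_zero (α := ℝ))
    have h' : ∫ x in (0 : ℝ)..(1 / 2), expTwoPi (t * cantorMap x)
        = ∫ x in (0 : ℝ)..(1 / 2), expTwoPi (t / 3 * cantorMap (2 * x)) := by
      refine intervalIntegral.integral_congr_ae ?_
      have : ∀ᵐ x : ℝ, x ≠ 1 / 2 := by simp [ae_iff]
      filter_upwards [this] with x hx hx'
      rw [Set.uIoc_of_le (by norm_num)] at hx'
      have hlt : x < 1 / 2 := lt_of_le_of_ne hx'.2 hx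
      have hfr : Int.fract x = x := Int.fract_eq_self.2 ⟨hx'.1.le, by linarith⟩
      rw [cantorMap_eq x, binaryDigit, hfr, if_pos hlt]
      congr 1; ring
    rw [h', h, cantorFourier]
    norm_num [div_eq_inv_mul]
  have hR : ∫ x in (1 / 2 : ℝ)..1, expTwoPi (t * cantorMap x)
      = expTwoPi (2 * (t / 3)) * cantorFourier (t / 3) / 2 := by
    have h := intervalIntegral.integral_comp_mul_left (a := 1 / 2) (b := 1)
      (fun x => expTwoPi (t / 3 * cantorMap x)) (two_ne_zero (α := ℝ))
    have h' : ∫ x in (1 / 2 : ℝ)..1, expTwoPi (t * cantorMap x)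
        = ∫ x in (1 / 2 : ℝ)..1, expTwoPi (2 * (t / 3)) * expTwoPi (t / 3 * cantorMap (2 * x)) := by
      refine intervalIntegral.integral_congr_ae ?_
      have : ∀ᵐ x : ℝ, x ≠ 1 := by simp [ae_iff]
      filter_upwards [this] with x hx hx'
      rw [Set.uIoc_of_le (by norm_num)] at hx'
      have hlt : x < 1 := lt_of_le_of_ne hx'.2 hx
      have hfr : Int.fract x = x := Int.fract_eq_self.2 ⟨by linarith [hx'.1], hlt⟩
      rw [cantorMap_eq x, binaryDigit, hfr, if_neg (not_lt.2 hx'.1.le), ← expTwoPi_add]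
      congr 1; ring
    have hp := hper.intervalIntegral_add_eq 1 0
    rw [h', intervalIntegral.integral_const_mul, h]
    norm_num at hp ⊢
    rw [hp, cantorFourier]
    ring
  rw [cantorFourier, ← intervalIntegral.integral_add_adjacent_intervals
    (intervalIntegrable_expTwoPi_cantorMap t 0 (1 / 2))
    (intervalIntegrable_expTwoPi_cantorMap t (1 / 2) 1), hL, hR, cantorFactor]
  ring

lemma cantorFourier_three_pow_mul (n : ℕ) (t : ℝ) :
    cantorFourier (3 ^ n * t) = (∏ j ∈ Finset.range n, cantorFactor (3 ^ j * t)) *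
      cantorFourier t := by
  induction n with
  | zero => simp
  | succ n ih =>
    have : (3 : ℝ) ^ (n + 1) * t / 3 = 3 ^ n * t := by ring
    rw [cantorFourier_eq, this, ih, Finset.prod_range_succ]; ring

lemma cantorFourier_three_pow (n : ℕ) : cantorFourier (3 ^ n) = cantorFourier 1 := by
  have h := cantorFourier_three_pow_mul n 1
  rw [mul_one] at h
  rw [h, Finset.prod_eq_one, one_mul]
  intro j _
  have := cantorFactor_nat (3 ^ j)
  push_cast at this
  rw [mul_one, this]

lemma tendsto_nat_div_three_pow : Tendsto (fun n : ℕ => (n : ℝ) / 3 ^ n) atTop (𝓝 0) := by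
  simpa using tendsto_pow_const_div_const_pow_of_one_lt 1 (by norm_num : (1 : ℝ) < 3)

/-- By continuity the transform is nonzero at some `1 / 3 ^ n`; multiplying back the nonvanishing
factors carries this up to 1. -/
lemma cantorFourier_one_ne_zero : cantorFourier 1 ≠ 0 := by
  have hlim : Tendsto (fun n : ℕ => cantorFourier (1 / 3 ^ n)) atTop (𝓝 1) := by
    have h : Tendsto (fun n : ℕ => (1 : ℝ) / 3 ^ n) atTop (𝓝 0) := by
      simpa using tendsto_pow_const_div_const_pow_of_one_lt 0 (by norm_num : (1 : ℝ) < 3)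
    simpa [cantorFourier_zero, Function.comp_def] using
      (continuous_cantorFourier.tendsto 0).comp h
  obtain ⟨n, hn⟩ := (hlim.eventually_ne one_ne_zero).exists
  have key : ∀ n : ℕ, cantorFourier (1 / 3 ^ n) ≠ 0 → cantorFourier 1 ≠ 0 := by
    intro n
    induction n with
    | zero => simp
    | succ n ih =>
      intro h
      apply ih
      have : (1 : ℝ) / 3 ^ n / 3 = 1 / 3 ^ (n + 1) := by rw [div_div, pow_succ]
      rw [cantorFourier_eq, this]
      exact mul_ne_zero (cantorFactor_inv_three_pow_ne_zero n) h
  exact key n hn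

lemma norm_cantorFourier_three_pow_add_le {n : ℕ} (hn : n ≠ 0) :
    ‖cantorFourier (3 ^ n + n)‖ ≤ 1 / 2 * ‖cantorFourier (1 + n / 3 ^ n)‖ := by
  have h := cantorFourier_three_pow_mul n (1 + n / 3 ^ n)
  have h3 : (3 : ℝ) ^ n ≠ 0 := by positivity
  rw [mul_add, mul_one, mul_div_cancel₀ _ h3] at h
  rw [h, norm_mul, norm_prod]
  refine mul_le_mul_of_nonneg_right ?_ (norm_nonneg _)
  -- With `n = 3 ^ k * m`, the factor of index `n - k - 1` has argument an integer plus `m / 3`, so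
  -- modulus 1/2.
  obtain ⟨k, m, hm, hkm⟩ := Nat.exists_eq_pow_mul_and_not_dvd hn 3 (by norm_num)
  have hk : k < n := by
    have h1 : k < 3 ^ k := Nat.lt_pow_self (by norm_num)
    have hm0 : 0 < m := Nat.pos_of_ne_zero fun h => hm (h ▸ dvd_zero 3)
    calc k < 3 ^ k := h1
      _ ≤ 3 ^ k * m := Nat.le_mul_of_pos_right _ hm0
      _ = n := hkm.symm
  have hmem : n - k - 1 ∈ Finset.range n := Finset.mem_range.2 (by omega)
  rw [← Finset.mul_prod_erase _ _ hmem]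
  have hfac : ‖cantorFactor (3 ^ (n - k - 1) * (1 + n / 3 ^ n))‖ = 1 / 2 := by
    have harg : (3 : ℝ) ^ (n - k - 1) * (1 + n / 3 ^ n) = ((3 ^ (n - k - 1) : ℕ) : ℝ) + m / 3 := by
      have hpow : (3 : ℝ) ^ n = 3 ^ (n - k - 1) * 3 ^ k * 3 := by
        rw [← pow_add, ← pow_succ]; congr 1; omega
      have hcast : (n : ℝ) = 3 ^ k * m := by exact_mod_cast hkm
      have h1 : (3 : ℝ) ^ (n - k - 1) ≠ 0 := by positivity
      have h2 : (3 : ℝ) ^ k ≠ 0 := by positivity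
      rw [hpow, hcast]; push_cast; field_simp
    rw [harg, cantorFactor_nat_add, norm_cantorFactor_div_three hm]
  rw [hfac]
  have : ∏ x ∈ (Finset.range n).erase (n - k - 1), ‖cantorFactor (3 ^ x * (1 + n / 3 ^ n))‖ ≤ 1 :=
    Finset.prod_le_one (fun _ _ => norm_nonneg _) fun _ _ => norm_cantorFactor_le _
  linarith

/-- The Fourier transform of the Cantor measure takes well separated values at `3 ^ n` and at
`3 ^ n + n`. -/
lemma eventually_cantorFourier_separated :
    ∀ᶠ n : ℕ in atTop, ‖cantorFourier 1‖ / 4 ≤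
      ‖cantorFourier (3 ^ n) - cantorFourier (3 ^ n + n)‖ := by
  have hlim : Tendsto (fun n : ℕ => ‖cantorFourier (1 + n / 3 ^ n)‖) atTop
      (𝓝 ‖cantorFourier 1‖) := by
    have h : Tendsto (fun n : ℕ => 1 + (n : ℝ) / 3 ^ n) atTop (𝓝 1) := by
      simpa using tendsto_nat_div_three_pow.const_add 1
    exact ((continuous_cantorFourier.tendsto 1).comp h).norm
  have hpos : 0 < ‖cantorFourier 1‖ := norm_pos_iff.2 cantorFourier_one_ne_zero
  -- The factor 3/2, halved, bounds the value at `3 ^ n + n` by 3/4 of the constant, leaving a gap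
  -- of 1/4.
  filter_upwards [hlim.eventually_lt_const (show ‖cantorFourier 1‖ < 3 / 2 * ‖cantorFourier 1‖ by
    linarith), eventually_ne_atTop 0] with n hn hn0
  have h1 := norm_cantorFourier_three_pow_add_le hn0
  have h2 := norm_sub_norm_le (cantorFourier (3 ^ n)) (cantorFourier (3 ^ n + n))
  rw [cantorFourier_three_pow] at h2 ⊢
  linarith

/-! ### Realization as a correlation -/

/-- The Fourier transform of the Cantor measure, restricted to `ℕ`, is the correlation sequence of
a skew product over the identity. -/
lemma isMultipleCorrelation_cantorFourier :
    IsMultipleCorrelation 1 fun n : ℕ => cantorFourier n := by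
  have hv : IsProbabilityMeasure (volume : Measure UnitAddCircle) := ⟨UnitAddCircle.measure_univ⟩
  have hr : IsProbabilityMeasure (volume.restrict (Set.Ioc (0 : ℝ) 1)) := ⟨by simp⟩
  have hθ : Measurable fun x : ℝ => ((cantorMap x : ℝ) : UnitAddCircle) :=
    AddCircle.measurable_mk'.comp measurable_cantorMap
  let T : ℝ × UnitAddCircle ≃ᵐ ℝ × UnitAddCircle :=
    { toFun := fun p => (p.1, p.2 + ((cantorMap p.1 : ℝ) : UnitAddCircle))
      invFun := fun p => (p.1, p.2 - ((cantorMap p.1 : ℝ) : UnitAddCircle))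
      left_inv := fun p => by simp
      right_inv := fun p => by simp
      measurable_toFun := measurable_fst.prodMk (measurable_snd.add (hθ.comp measurable_fst))
      measurable_invFun := measurable_fst.prodMk (measurable_snd.sub (hθ.comp measurable_fst)) }
  have hT : ∀ (n : ℕ) (p : ℝ × UnitAddCircle),
      T^[n] p = (p.1, p.2 + ((n * cantorMap p.1 : ℝ) : UnitAddCircle)) := by
    intro n p
    induction n with
    | zero => simp
    | succ n ih =>
      rw [Function.iterate_succ_apply', ih]
      change (p.1, _) = _
      simp [add_mul, add_assoc]
  refine ⟨ℝ × UnitAddCircle, inferInstance, inferInstance,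
    (volume.restrict (Set.Ioc (0 : ℝ) 1)).prod volume, inferInstance, T,
    ![fun p => fourier (-1) p.2, fun p => fourier 1 p.2], ?_, ?_, ?_, ?_⟩
  · exact (MeasurePreserving.id (volume.restrict (Set.Ioc (0 : ℝ) 1))).skew_product
      (g := fun x y => y + ((cantorMap x : ℝ) : UnitAddCircle))
      (measurable_snd.add (hθ.comp measurable_fst))
      (.of_forall fun x => (measurePreserving_add_right volume _).map_eq)
  · intro j
    fin_cases j
    · exact (map_continuous (fourier (T := 1) (-1))).measurable.comp measurable_snd
    · exact (map_continuous (fourier (T := 1) 1)).measurable.comp measurable_snd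
  · intro j
    refine ⟨1, fun p => ?_⟩
    fin_cases j <;> exact (Circle.norm_coe _).le
  · intro n
    have hint : ∀ p : ℝ × UnitAddCircle, ∏ j : Fin 2,
        (![fun p => fourier (-1) p.2, fun p => fourier 1 p.2] :
          Fin 2 → ℝ × UnitAddCircle → ℂ) j (T^[(j : ℕ) * n] p)
        = expTwoPi (n * cantorMap p.1) := by
      intro p
      have h0 : fourier (-1) p.2 * fourier 1 p.2 = 1 := by rw [← fourier_add]; simp
      have h1 : fourier 1 (((n * cantorMap p.1 : ℝ) : UnitAddCircle))
          = expTwoPi (n * cantorMap p.1) := by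
        rw [fourier_coe_apply, expTwoPi]
        congr 1; push_cast; ring
      simp only [Fin.prod_univ_two, Matrix.cons_val_zero, Matrix.cons_val_one, hT]
      rw [← h1]
      have h2 : fourier 1 (p.2 + ((n * cantorMap p.1 : ℝ) : UnitAddCircle)) =
          fourier 1 p.2 * fourier 1 ((n * cantorMap p.1 : ℝ) : UnitAddCircle) := by
        simp only [fourier_one, AddCircle.toCircle_add, Circle.coe_mul]
      simp only [Fin.val_zero, Fin.val_one, zero_mul, Nat.cast_zero, one_mul, AddCircle.coe_zero,
        add_zero]
      rw [h2, ← mul_assoc, h0, one_mul]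
    simp only [hint]
    have := integral_fun_fst (μ := volume.restrict (Set.Ioc (0 : ℝ) 1))
      (ν := (volume : Measure UnitAddCircle)) (fun x => expTwoPi (n * cantorMap x))
    rw [this, cantorFourier, intervalIntegral.integral_of_le zero_le_one]
    simp

/-! ### Almost periods -/

/-- For a continuous function on a compact group, the almost periods along a one-parameter orbit
are syndetic. -/
lemma exists_syndetic_almost_period {K : Type*} [Group K] [TopologicalSpace K]
    [IsTopologicalGroup K] [CompactSpace K] (F : C(K, ℂ)) (g : K) {ε : ℝ} (hε : 0 < ε) :
    ∃ M : ℕ, ∀ n : ℕ, ∃ s, n ≤ s ∧ s ≤ n + M ∧ ∀ y, ‖F (g ^ s * y) - F y‖ < ε := by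
  -- The translates of `F` form a compact set in the sup norm, so finitely many `g ^ idx f`
  -- translates approximate all of them; differences of exponents are then almost periods.
  let Φ : C(K, C(K, ℂ)) := ContinuousMap.curry ⟨fun p : K × K => F (p.1 * p.2), by fun_prop⟩
  have hΦ : ∀ x y, Φ x y = F (x * y) := fun _ _ => rfl
  have htb : TotallyBounded (Set.range fun n : ℕ => Φ (g ^ n)) :=
    (isCompact_range Φ.continuous).totallyBounded.subset (by
      rintro _ ⟨n, rfl⟩; exact ⟨_, rfl⟩)
  obtain ⟨t, hts, htf, hcov⟩ := Metric.finite_approx_of_totallyBounded htb ε hε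
  have hts' : ∀ f ∈ t, ∃ n : ℕ, Φ (g ^ n) = f := fun f hf => hts hf
  choose! idx hidx using hts'
  obtain ⟨M, hM⟩ := (htf.image idx).bddAbove
  refine ⟨M, fun n => ?_⟩
  obtain ⟨f, hf, hn⟩ : ∃ f ∈ t, Φ (g ^ (n + M)) ∈ Metric.ball f ε := by
    simpa only [Set.mem_iUnion, exists_prop] using hcov ⟨n + M, rfl⟩
  have hiM : idx f ≤ M := hM ⟨f, hf, rfl⟩
  have hfi : Φ (g ^ idx f) = f := hidx f hf
  rw [← hfi] at hn
  refine ⟨n + M - idx f, by omega, by omega, fun y => ?_⟩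
  rw [Metric.mem_ball, ContinuousMap.dist_lt_iff hε] at hn
  have h := hn ((g ^ idx f)⁻¹ * y)
  rwa [hΦ, hΦ, mul_inv_cancel_left, dist_eq_norm, ← mul_assoc,
    ← pow_sub _ (by omega)] at h

/-- The almost periods of a `1`-step nilsequence are syndetic. -/
lemma IsNilsequence.exists_syndetic_almost_period {φ : ℕ → ℂ} (hφ : IsNilsequence 1 φ)
    {ε : ℝ} (hε : 0 < ε) :
    ∃ M : ℕ, ∀ n : ℕ, ∃ s, n ≤ s ∧ s ≤ n + M ∧ ∀ m, ‖φ (m + s) - φ m‖ < ε := by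
  obtain ⟨G, _, _, _, d, _, _, Γ, F, g, x, hG, _, _, hφ⟩ := hφ
  have : IsTopologicalGroup G := topologicalGroup_of_lieGroup (𝓡 d) ∞
  have hcomm : ∀ a b : G, a * b = b * a := by
    intro a b
    have hc : Subgroup.center G = ⊤ := by simpa [Subgroup.lowerCentralSeries] using hG
    exact (Subgroup.mem_center_iff.1 (hc ▸ Subgroup.mem_top b) a)
  have : Γ.Normal := ⟨fun a ha b => by rwa [hcomm b a, mul_inv_cancel_right]⟩
  have hsmul : ∀ n : ℕ, g ^ n • x = (g : G ⧸ Γ) ^ n * x := by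
    intro n
    induction x using QuotientGroup.induction_on with
    | H z => rfl
  obtain ⟨M, hM⟩ := _root_.exists_syndetic_almost_period F (g : G ⧸ Γ) hε
  refine ⟨M, fun n => ?_⟩
  obtain ⟨s, h1, h2, h3⟩ := hM n
  refine ⟨s, h1, h2, fun m => ?_⟩
  rw [hφ, hφ, hsmul, hsmul, add_comm, pow_add, mul_assoc]
  exact h3 _

lemma IsNilsequence.exists_norm_le {k : ℕ} {φ : ℕ → ℂ} (hφ : IsNilsequence k φ) :
    ∃ C : ℝ, ∀ n, ‖φ n‖ ≤ C := by
  obtain ⟨G, _, _, _, d, _, _, Γ, F, g, x, _, _, _, hφ⟩ := hφ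
  exact ⟨‖F‖, fun n => by rw [hφ]; exact F.norm_coe_le_norm _⟩

lemma IsAlmostPeriodic.exists_norm_le {ψ : ℕ → ℂ} (hψ : IsAlmostPeriodic ψ) :
    ∃ C : ℝ, ∀ n, ‖ψ n‖ ≤ C := by
  obtain ⟨φ, hφ, h⟩ := hψ 1 one_pos
  obtain ⟨C, hC⟩ := hφ.exists_norm_le
  refine ⟨C + 1, fun n => ?_⟩
  have := norm_le_norm_add_norm_sub' (ψ n) (φ n)
  linarith [hC n, h n]

lemma IsAlmostPeriodic.exists_syndetic_almost_period {ψ : ℕ → ℂ} (hψ : IsAlmostPeriodic ψ)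
    {ε : ℝ} (hε : 0 < ε) :
    ∃ M : ℕ, ∀ n : ℕ, ∃ s, n ≤ s ∧ s ≤ n + M ∧ ∀ m, ‖ψ (m + s) - ψ m‖ < ε := by
  obtain ⟨φ, hφ, h⟩ := hψ (ε / 3) (by positivity)
  obtain ⟨M, hM⟩ := hφ.exists_syndetic_almost_period (show 0 < ε / 3 by positivity)
  refine ⟨M, fun n => ?_⟩
  obtain ⟨s, h1, h2, h3⟩ := hM n
  refine ⟨s, h1, h2, fun m => ?_⟩
  have e : ψ (m + s) - ψ m = (ψ (m + s) - φ (m + s)) + (φ (m + s) - φ m) - (ψ m - φ m) := by ring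
  have := norm_sub_le ((ψ (m + s) - φ (m + s)) + (φ (m + s) - φ m)) (ψ m - φ m)
  have := norm_add_le (ψ (m + s) - φ (m + s)) (φ (m + s) - φ m)
  rw [e]
  linarith [h m, h (m + s), h3 m]

/-! ### Lower means -/

/-- A bounded nonnegative sequence whose sums over all late windows of a fixed length are bounded
below has positive lower mean. -/
lemma liminf_mean_pos {b : ℕ → ℝ} (hb : ∀ n, 0 ≤ b n) {B : ℝ} (hB : ∀ n, b n ≤ B)
    {n₀ L : ℕ} (hL : 0 < L) {η : ℝ} (hη : 0 < η)
    (h : ∀ n, n₀ ≤ n → η ≤ ∑ i ∈ Finset.range L, b (n + i)) :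
    0 < liminf (fun N : ℕ => (1 / (N : ℝ)) * ∑ n ∈ Finset.range N, b n) atTop := by
  have hq : ∀ q : ℕ, q * η ≤ ∑ n ∈ Finset.range (n₀ + L * q), b n := by
    intro q
    induction q with
    | zero => simpa using Finset.sum_nonneg fun n _ => hb n
    | succ q ih =>
      rw [Nat.mul_succ, ← add_assoc, Finset.sum_range_add]
      have := h (n₀ + L * q) (by omega)
      push_cast
      linarith
  have hL' : (0 : ℝ) < L := by exact_mod_cast hL
  have hcob : IsCoboundedUnder (· ≥ ·) atTop
      (fun N : ℕ => (1 / (N : ℝ)) * ∑ n ∈ Finset.range N, b n) := by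
    refine IsBoundedUnder.isCoboundedUnder_ge ⟨B, ?_⟩
    rw [eventually_map]
    filter_upwards [eventually_gt_atTop 0] with N hN
    have hN' : (0 : ℝ) < N := by exact_mod_cast hN
    have : ∑ n ∈ Finset.range N, b n ≤ N * B := by
      simpa using Finset.sum_le_card_nsmul (Finset.range N) b B fun n _ => hB n
    rw [one_div, inv_mul_le_iff₀ hN']
    exact this
  refine lt_of_lt_of_le (show 0 < η / (2 * L) by positivity) (le_liminf_of_le hcob ?_)
  filter_upwards [eventually_ge_atTop (2 * (n₀ + L))] with N hN
  have hN' : (0 : ℝ) < N := by exact_mod_cast (by omega : 0 < N)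
  set q := (N - n₀) / L with hqdef
  have h1 : n₀ + L * q ≤ N := by
    have := Nat.mul_div_le (N - n₀) L
    rw [← hqdef] at this
    omega
  have h2 : N < n₀ + L * (q + 1) := by
    have := Nat.lt_mul_div_succ (N - n₀) hL
    rw [← hqdef] at this
    omega
  have h3 : ∑ n ∈ Finset.range (n₀ + L * q), b n ≤ ∑ n ∈ Finset.range N, b n :=
    Finset.sum_le_sum_of_subset_of_nonneg (Finset.range_mono h1) fun n _ _ => hb n
  have h4 : (N : ℝ) ≤ 2 * L * q := by
    have : N ≤ 2 * L * q := by nlinarith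
    exact_mod_cast this
  rw [one_div, ← div_eq_inv_mul, div_le_div_iff₀ (by positivity) hN']
  have h5 := (hq q).trans h3
  nlinarith

/-! ### The enumeration and the conclusion -/

/-- The increasing enumeration of `{3 ^ n} ∪ {3 ^ n + n}`, `n ≥ 1`. -/
def threePowEnum (n : ℕ) : ℕ := 3 ^ (n / 2 + 1) + if n % 2 = 0 then 0 else n / 2 + 1

lemma threePowEnum_two_mul (k : ℕ) : threePowEnum (2 * k) = 3 ^ (k + 1) := by
  simp [threePowEnum]

lemma threePowEnum_two_mul_add_one (k : ℕ) :
    threePowEnum (2 * k + 1) = 3 ^ (k + 1) + (k + 1) := by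
  have h1 : (2 * k + 1) / 2 = k := by omega
  have h2 : (2 * k + 1) % 2 = 1 := by omega
  simp [threePowEnum, h1, h2]

lemma strictMono_threePowEnum : StrictMono threePowEnum := by
  refine strictMono_nat_of_lt_succ fun n => ?_
  obtain ⟨k, rfl | rfl⟩ := n.even_or_odd'
  · rw [threePowEnum_two_mul, threePowEnum_two_mul_add_one]; omega
  · rw [show 2 * k + 1 + 1 = 2 * (k + 1) by ring, threePowEnum_two_mul,
      threePowEnum_two_mul_add_one, pow_succ 3 (k + 1)]
    have : k + 1 < 3 ^ (k + 1) := Nat.lt_pow_self (by norm_num)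
    omega

lemma range_threePowEnum : Set.range threePowEnum =
    {m : ℕ | ∃ n : ℕ, 1 ≤ n ∧ m = 3 ^ n} ∪ {m : ℕ | ∃ n : ℕ, 1 ≤ n ∧ m = 3 ^ n + n} := by
  ext m
  constructor
  · rintro ⟨n, rfl⟩
    obtain ⟨k, rfl | rfl⟩ := n.even_or_odd'
    · exact .inl ⟨k + 1, by omega, threePowEnum_two_mul k⟩
    · exact .inr ⟨k + 1, by omega, threePowEnum_two_mul_add_one k⟩
  · rintro (⟨n, hn, rfl⟩ | ⟨n, hn, rfl⟩) <;> obtain ⟨k, rfl⟩ := Nat.exists_eq_add_of_le' hn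
    · exact ⟨2 * k, threePowEnum_two_mul k⟩
    · exact ⟨2 * k + 1, threePowEnum_two_mul_add_one k⟩

theorem proposition1p7 :
    ∃ r : ℕ → ℕ, StrictMono r ∧
      Set.range r = {m : ℕ | ∃ n : ℕ, 1 ≤ n ∧ m = 3 ^ n} ∪ {m : ℕ | ∃ n : ℕ, 1 ≤ n ∧ m = 3 ^ n + n} ∧
      ∃ a : ℕ → ℂ, IsMultipleCorrelation 1 a ∧
        ∀ ψ : ℕ → ℂ, IsAlmostPeriodic ψ →
          0 < liminf (fun N : ℕ => (1 / (N : ℝ)) * ∑ n ∈ Finset.range N, ‖a (r n) - ψ (r n)‖)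
            atTop := by
  refine ⟨threePowEnum, strictMono_threePowEnum, range_threePowEnum, _,
    isMultipleCorrelation_cantorFourier, fun ψ hψ => ?_⟩
  obtain ⟨C, hC⟩ := hψ.exists_norm_le
  have hc : 0 < ‖cantorFourier 1‖ := norm_pos_iff.2 cantorFourier_one_ne_zero
  obtain ⟨M, hM⟩ := hψ.exists_syndetic_almost_period (show 0 < ‖cantorFourier 1‖ / 8 by positivity)
  obtain ⟨s₀, hs₀⟩ := eventually_atTop.1 eventually_cantorFourier_separated
  refine liminf_mean_pos (fun n => norm_nonneg _) (B := 1 + C) (fun n => ?_) (n₀ := 2 * s₀)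
    (L := 2 * M + 4) (by omega) (show 0 < ‖cantorFourier 1‖ / 8 by positivity) fun n hn => ?_
  · exact (norm_sub_le _ _).trans (add_le_add (norm_cantorFourier_le _) (hC _))
  -- The points `3 ^ s` and `3 ^ s + s` have indices `2 * (s - 1)` and `2 * (s - 1) + 1`; starting
  -- at `n / 2 + 2` puts both in the window of length `2 * M + 4` from `n`.
  obtain ⟨s, hs1, hs2, hs⟩ := hM (n / 2 + 2)
  obtain ⟨k, rfl⟩ : ∃ k, s = k + 1 := ⟨s - 1, by omega⟩
  obtain ⟨i, hi⟩ : ∃ i, 2 * k = n + i := Nat.exists_eq_add_of_le (by omega)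
  have hsub : ({i, i + 1} : Finset ℕ) ⊆ Finset.range (2 * M + 4) := by
    intro j hj
    rw [Finset.mem_insert, Finset.mem_singleton] at hj
    rw [Finset.mem_range]
    omega
  refine le_trans ?_ (Finset.sum_le_sum_of_subset_of_nonneg hsub fun _ _ _ => norm_nonneg _)
  rw [Finset.sum_pair (by omega), ← add_assoc, ← hi, threePowEnum_two_mul,
    threePowEnum_two_mul_add_one]
  have h1 := hs₀ (k + 1) (by omega)
  -- The almost period serves as the shift itself; the gap 1/4 less the error 1/8 leaves 1/8.
  have h2 := hs (3 ^ (k + 1))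
  set u := ψ (3 ^ (k + 1))
  set v := ψ (3 ^ (k + 1) + (k + 1))
  push_cast at h1 ⊢
  set p := cantorFourier (3 ^ (k + 1))
  set q := cantorFourier (3 ^ (k + 1) + (k + 1))
  have e : p - q = (p - u) - (v - u) - (q - v) := by ring
  have h3 := norm_sub_le ((p - u) - (v - u)) (q - v)
  have h4 := norm_sub_le (p - u) (v - u)
  rw [← e] at h3
  linarith
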